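/- All groups are abelian and written additively, and an LCA group is a locally compact Hausdorff abelian topological group. For an LCA group $G$ let $\mathrm{tor}(G)$ be the subgroup of elements of finite order and let $\mathrm{comp}(G)$ be the union of all compact subgroups of $G$ (a subgroup of $G$); $G$ is \emph{periodic} if it is totally disconnected and $\mathrm{comp}(G)=G$. $G$ is \emph{topologically modular} if $\overline{A+(B\cap C)}=\overline{A+B}\cap C$ for all closed subgroups $A,B,C$ of $G$ with $A\subseteq C$, and \emph{strongly topologically quasihamiltonian} if $X+Y$ is closed for all closed subgroups $X,Y$ of $G$. The $\mathbb Z$-rank of an abelian group $A$ is $\dim_{\mathbb Q}(A\otimes_{\mathbb Z}\mathbb Q)$. Let $G$ be a totally disconnected LCA group that is neither discrete nor periodic, and put $T=\mathrm{tor}(G)$. Then the following statements are equivalent. (a) $G$ is topologically modular. (b) Both of the following hold: (b.1) $T=\mathrm{tor}(G)=\mathrm{comp}(G)$ is open in $G$, and $G/T$ is discrete and torsion-free of finite $\mathbb Z$-rank; (b.2) the torsion subgroup $T$ (with the subspace topology) is strongly topologically quasihamiltonian. (c) $G$ is strongly topologically quasihamiltonian. Moreover, let $N$ be any closed subgroup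 of $G$ contained in $T$. Then $\mathrm{tor}(G/N)=T/N$; and if (b) holds for $G$, then (b) holds for $G/N$ with $T$ replaced by $T/N$, that is, $T/N=\mathrm{tor}(G/N)=\mathrm{comp}(G/N)$ is open in $G/N$, $(G/N)/(T/N)$ is discrete and torsion-free of finite $\mathbb Z$-rank, and $T/N$ is strongly topologically quasihamiltonian. -/

import Mathlib

open scoped Pointwise TensorProduct

/-- `G` is topologically modular: the modular law holds in the lattice of closed subgroups,
whose meet is the intersection and whose join is the closure of the generated subgroup. -/
def TopologicallyModular (G : Type*) [AddCommGroup G] [TopologicalSpace G]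
    [IsTopologicalAddGroup G] : Prop :=
  ∀ A B C : AddSubgroup G, IsClosed (A : Set G) → IsClosed (B : Set G) → IsClosed (C : Set G) →
    A ≤ C → (A ⊔ (B ⊓ C)).topologicalClosure = (A ⊔ B).topologicalClosure ⊓ C

/-- `G` is strongly topologically quasihamiltonian: the sum `X + Y` of any two closed subgroups
is closed. -/
def StronglyTopologicallyQuasihamiltonian (G : Type*) [AddCommGroup G] [TopologicalSpace G] :
    Prop :=
  ∀ X Y : AddSubgroup G, IsClosed (X : Set G) → IsClosed (Y : Set G) →
    IsClosed ((X : Set G) + (Y : Set G))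

/-- `comp(G)`: the union of all compact subgroups, which is a subgroup since `G` is abelian. -/
def compSubgroup (G : Type*) [AddCommGroup G] [TopologicalSpace G] [IsTopologicalAddGroup G] :
    AddSubgroup G where
  carrier := {x | ∃ K : AddSubgroup G, IsCompact (K : Set G) ∧ x ∈ K}
  zero_mem' := ⟨⊥, by simp, zero_mem _⟩
  neg_mem' := by
    rintro x ⟨K, hK, hx⟩
    exact ⟨K, hK, neg_mem hx⟩
  add_mem' := by
    rintro x y ⟨K, hK, hx⟩ ⟨L, hL, hy⟩
    refine ⟨K ⊔ L, ?_, AddSubgroup.add_mem_sup hx hy⟩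
    rw [AddSubgroup.add_normal]
    exact hK.add hL

/-- `G` is periodic: totally disconnected and the union of its compact subgroups. -/
def IsPeriodicGroup (G : Type*) [AddCommGroup G] [TopologicalSpace G] : Prop :=
  TotallyDisconnectedSpace G ∧ ∀ x : G, ∃ K : AddSubgroup G, IsCompact (K : Set G) ∧ x ∈ K

/-- The `ℤ`-rank (torsion-free rank) of an abelian group: the `ℚ`-dimension of `ℚ ⊗ A`. -/
noncomputable def zRank (A : Type*) [AddCommGroup A] : Cardinal :=
  Module.rank ℚ (ℚ ⊗[ℤ] A)

/-- The structural condition on a group `G` and a subgroup `T`: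
`T = tor(G) = comp(G)` is open, `G/T` is discrete and torsion-free of finite `ℤ`-rank, and `T`,
with the subspace topology, is strongly topologically quasihamiltonian. -/
structure ModularStructure (G : Type*) [AddCommGroup G] [TopologicalSpace G]
    [IsTopologicalAddGroup G] (T : AddSubgroup G) : Prop where
  eq_torsion : T = AddCommGroup.torsion G
  eq_comp : T = compSubgroup G
  isOpen : IsOpen (T : Set G)
  discrete_quotient : DiscreteTopology (G ⧸ T)
  torsionFree_quotient : IsAddTorsionFree (G ⧸ T)
  finite_rank_quotient : zRank (G ⧸ T) < Cardinal.aleph0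
  strongly_quasihamiltonian : StronglyTopologicallyQuasihamiltonian T

/-! When sums of closed subgroups are closed, the closures in the modular law disappear and it
becomes Dedekind's law; this is (c) ⇒ (a). For (a) ⇒ (b), take `x` outside `comp(G)`, which is open.
No nonzero multiple of `x` lies in `comp(G)`, so a subgroup generated by a multiple of `x + c` with
`c ∈ comp(G)` meets `comp(G)` trivially and is closed. Twisting such subgroups by elements of
`comp(G)` gives closed `A ≤ C` and `B` with `B ∩ C` small and `A + B` accumulating at a chosen point
of `C`. Three such choices show that `comp(G)` is torsion, that sums of closed subgroups of `T` are
closed, and that `G/T` has finite rank. For (b) ⇒ (c), Baire gives an open subgroup `V` of some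
exponent `n`. Modulo the closed subgroup `N = (X ∩ T) + (Y ∩ T)`, the part of `X + Y` in the open
subgroup `V + N` is a quotient of `D/nD` for some `D ≤ G/T`, which is finite by the rank condition.
Hence `X + Y` is closed. -/

/-! ### Open and compact subgroups, `comp(G)`, and the modular law. -/

section TopologicalPreliminaries

variable {G : Type*} [AddCommGroup G] [TopologicalSpace G] [IsTopologicalAddGroup G]

/-- Van Dantzig's theorem. -/
theorem exists_isOpen_isCompact_addSubgroup [LocallyCompactSpace G] [T2Space G]
    [TotallyDisconnectedSpace G] {O : Set G} (hO : O ∈ nhds (0 : G)) :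
    ∃ U : AddSubgroup G, IsOpen (U : Set G) ∧ IsCompact (U : Set G) ∧ (U : Set G) ⊆ O := by
  obtain ⟨K, hK, hKO, hKc⟩ := LocallyCompactSpace.local_compact_nhds (0 : G) O hO
  obtain ⟨W, hW, h0W, hWK⟩ := loc_compact_Haus_tot_disc_of_zero_dim.mem_nhds_iff.mp hK
  have hWc : IsCompact W := hKc.of_isClosed_subset hW.1 hWK
  obtain ⟨V, hV, hWV⟩ := compact_open_separated_add_right hWc hW.2 subset_rfl
  -- The stabiliser of the compact open set `W` under translation; asking for both signs makes it
  -- closed under negation, and `0 ∈ W` puts it inside `W`.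
  let U : AddSubgroup G :=
    { carrier := {g | ∀ w ∈ W, w + g ∈ W ∧ w - g ∈ W}
      zero_mem' := by simp
      add_mem' := by
        intro a b ha hb w hw
        exact ⟨by rw [← add_assoc]; exact (hb _ (ha w hw).1).1,
          by rw [← sub_sub]; exact (hb _ (ha w hw).2).2⟩
      neg_mem' := by
        intro a ha w hw
        exact ⟨by simpa [sub_eq_add_neg] using (ha w hw).2, by simpa using (ha w hw).1⟩ }
  have hUW : (U : Set G) ⊆ W := fun g hg => by simpa using (hg 0 h0W).1
  have hUo : IsOpen (U : Set G) := by
    refine AddSubgroup.isOpen_of_mem_nhds U (g := 0) ?_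
    filter_upwards [hV, neg_mem_nhds_zero G hV] with g hg hg' w hw
    exact ⟨hWV (Set.add_mem_add hw hg), by
      rw [sub_eq_add_neg]; exact hWV (Set.add_mem_add hw hg')⟩
  exact ⟨U, hUo, hWc.of_isClosed_subset (U.isClosed_of_isOpen hUo) hUW, hUW.trans (hWK.trans hKO)⟩

/-- A limit point `x` of `S` differs from some `s ∈ S` by an element of `T`. As `T` is open, `x - s`
is a limit of points of `S ∩ T`, so it lies there. -/
theorem AddSubgroup.isClosed_of_isClosed_inf {S T : AddSubgroup G} (hT : IsOpen (T : Set G))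
    (h : IsClosed ((S ⊓ T : AddSubgroup G) : Set G)) : IsClosed (S : Set G) := by
  refine isClosed_of_closure_subset fun x hx => ?_
  have hnhds : {y | x - y ∈ T} ∈ nhds x := by
    have : Continuous fun y => x - y := by fun_prop
    exact (hT.preimage this).mem_nhds (by simp [zero_mem])
  obtain ⟨s, hsT, hsS⟩ := mem_closure_iff_nhds.mp hx _ hnhds
  have hx' : x ∈ S.topologicalClosure := hx
  have h1 : x - s ∈ S.topologicalClosure := sub_mem hx' (S.le_topologicalClosure hsS)
  have h2 := hT.inter_closure ⟨hsT, h1⟩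
  rw [Set.inter_comm] at h2
  have h3 : x - s ∈ S ⊓ T := h.closure_subset h2
  simpa using add_mem h3.1 hsS

theorem AddSubgroup.isClosed_of_disjoint [T1Space G] {S T : AddSubgroup G}
    (hT : IsOpen (T : Set G)) (h : ∀ x ∈ S, x ∈ T → x = 0) : IsClosed (S : Set G) := by
  refine AddSubgroup.isClosed_of_isClosed_inf hT ?_
  have : S ⊓ T = ⊥ := (AddSubgroup.eq_bot_iff_forall _).mpr fun x hx => h x hx.1 hx.2
  simp [this]

theorem exists_nsmul_mem_of_isCompact {K U : AddSubgroup G} (hK : IsCompact (K : Set G))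
    (hU : IsOpen (U : Set G)) {c : G} (hc : c ∈ K) : ∃ m : ℕ, 0 < m ∧ m • c ∈ U := by
  have := QuotientAddGroup.discreteTopology hU
  have hfin : (QuotientAddGroup.mk' U '' (K : Set G)).Finite :=
    (hK.image QuotientAddGroup.continuous_mk).finite_of_discrete
  have : Finite (K.map (QuotientAddGroup.mk' U)) := hfin.to_subtype
  have h := isOfFinAddOrder_of_finite
    (⟨QuotientAddGroup.mk' U c, ⟨c, hc, rfl⟩⟩ : K.map (QuotientAddGroup.mk' U))
  obtain ⟨m, hm, h⟩ := isOfFinAddOrder_iff_nsmul_eq_zero.mp h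
  refine ⟨m, hm, (QuotientAddGroup.eq_zero_iff _).mp ?_⟩
  have := congrArg Subtype.val h
  simpa using this

theorem torsion_le_compSubgroup : AddCommGroup.torsion G ≤ compSubgroup G := by
  intro x hx
  have hx : IsOfFinAddOrder x := hx
  refine ⟨AddSubgroup.zmultiples x, ?_, AddSubgroup.mem_zmultiples x⟩
  have : Finite (AddSubgroup.zmultiples x) := finite_zmultiples.mpr hx
  exact (Set.toFinite _).isCompact

theorem isOpen_compSubgroup [LocallyCompactSpace G] [T2Space G] [TotallyDisconnectedSpace G] :
    IsOpen (compSubgroup G : Set G) := by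
  obtain ⟨U, hUo, hUc, -⟩ :=
    exists_isOpen_isCompact_addSubgroup (G := G) (O := Set.univ) Filter.univ_mem
  exact AddSubgroup.isOpen_mono (fun x hx => ⟨U, hUc, hx⟩) hUo

/-- An element outside `comp(G)` has no nonzero multiple in `comp(G)`. -/
theorem eq_zero_of_zsmul_mem_compSubgroup {x : G}
    (hx : x ∉ compSubgroup G) {m : ℤ} (hm : m • x ∈ compSubgroup G) : m = 0 := by
  by_contra hne
  apply hx
  obtain ⟨K, hK, hmK⟩ := hm
  have hn : m.natAbs • x ∈ K := by
    rcases Int.natAbs_eq m with h | h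
    · rw [h, natCast_zsmul] at hmK; exact hmK
    · rw [h, neg_smul, natCast_zsmul] at hmK; simpa using hmK
  refine ⟨K ⊔ AddSubgroup.zmultiples x, ?_, AddSubgroup.mem_sup_right
    (AddSubgroup.mem_zmultiples x)⟩
  -- Since `|m| • x ∈ K`, the sum `K + ℤx` is a finite union of translates of `K`, hence compact.
  have hset : ((K ⊔ AddSubgroup.zmultiples x : AddSubgroup G) : Set G) =
      (K : Set G) + (fun i : ℕ => i • x) '' Set.Iio m.natAbs := by
    ext y
    constructor
    · intro hy
      obtain ⟨k, hk, z, hz, rfl⟩ := AddSubgroup.mem_sup.mp hy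
      obtain ⟨i, rfl⟩ := AddSubgroup.mem_zmultiples_iff.mp hz
      have hpos : (0 : ℤ) < m.natAbs := by omega
      have h0 := Int.emod_nonneg i hpos.ne'
      have h1 := Int.emod_lt_of_pos i hpos
      refine ⟨k + (i / m.natAbs) • (m.natAbs • x), K.add_mem hk (K.zsmul_mem hn _),
        ((i % m.natAbs).toNat) • x, ⟨_, ?_, rfl⟩, ?_⟩
      · simp only [Set.mem_Iio]; omega
      · dsimp only
        rw [← natCast_zsmul x (Int.toNat _), Int.toNat_of_nonneg h0, add_assoc,
          ← natCast_zsmul x m.natAbs, smul_smul, ← add_smul, mul_comm, Int.mul_ediv_add_emod]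
    · rintro ⟨k, hk, _, ⟨i, -, rfl⟩, rfl⟩
      exact AddSubgroup.add_mem_sup hk (AddSubgroup.nsmul_mem _ (AddSubgroup.mem_zmultiples x) i)
  rw [hset]
  exact hK.add ((Set.finite_Iio _).image _).isCompact

/-- The closed subgroup form of the modular law: a point of `C` in the closure of `A + B` lies in
every closed subgroup containing `A` and `B ∩ C`. -/
theorem TopologicallyModular.mem (h : TopologicallyModular G) {A B C D : AddSubgroup G}
    (hA : IsClosed (A : Set G)) (hB : IsClosed (B : Set G)) (hC : IsClosed (C : Set G))
    (hD : IsClosed (D : Set G)) (hAC : A ≤ C) (hAD : A ≤ D) (hBCD : B ⊓ C ≤ D) {x : G}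
    (hxC : x ∈ C) (hx : x ∈ (A ⊔ B).topologicalClosure) : x ∈ D := by
  have h1 : x ∈ (A ⊔ (B ⊓ C)).topologicalClosure := by
    rw [h A B C hA hB hC hAC]; exact ⟨hx, hxC⟩
  exact AddSubgroup.topologicalClosure_minimal _ (sup_le hAD hBCD) hD h1

theorem StronglyTopologicallyQuasihamiltonian.topologicallyModular
    (h : StronglyTopologicallyQuasihamiltonian G) : TopologicallyModular G := by
  intro A B C hA hB hC hAC
  have key : ∀ X Y : AddSubgroup G, IsClosed (X : Set G) → IsClosed (Y : Set G) →
      (X ⊔ Y).topologicalClosure = X ⊔ Y := by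
    intro X Y hX hY
    refine le_antisymm (AddSubgroup.topologicalClosure_minimal _ le_rfl ?_)
      (AddSubgroup.le_topologicalClosure _)
    rw [AddSubgroup.add_normal]
    exact h X Y hX hY
  rw [key A B hA hB, key A (B ⊓ C) hA (hB.inter hC)]
  exact (sup_inf_assoc_of_le B hAC).symm

end TopologicalPreliminaries

/-! ### Modularity forces torsion and closed sums inside `T`. -/

section ModularConsequences

variable {G : Type*} [AddCommGroup G] [TopologicalSpace G] [IsTopologicalAddGroup G]
  [LocallyCompactSpace G] [T2Space G] [TotallyDisconnectedSpace G]

/-- Modulo an open subgroup `U`, some `q ^ a * r` with `q ∤ r` kills `c`. As `s` is congruent to a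
multiple of `q ^ a • c`, it is killed by `r`, and Bézout for `r` and `q` makes it a multiple of `q •
s` modulo `U`. -/
theorem mem_closure_zmultiples_smul_of_divisible {K : AddSubgroup G} (hK : IsCompact (K : Set G))
    {c s : G} (hc : c ∈ K) {q : ℕ} (hq : q.Prime)
    (hs : ∀ n : ℕ, s ∈ (AddSubgroup.zmultiples ((q ^ n : ℤ) • c)).topologicalClosure) :
    s ∈ (AddSubgroup.zmultiples ((q : ℤ) • s)).topologicalClosure := by
  have approx : ∀ (Z : AddSubgroup G), s ∈ Z.topologicalClosure → ∀ U : AddSubgroup G,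
      IsOpen (U : Set G) → ∃ z ∈ Z, s - z ∈ U := by
    intro Z hZ U hU
    have hnhds : {y | s - y ∈ U} ∈ nhds s := by
      have : Continuous fun y => s - y := by fun_prop
      exact (hU.preimage this).mem_nhds (by simp [zero_mem])
    obtain ⟨z, h1, h2⟩ := mem_closure_iff_nhds.mp hZ _ hnhds
    exact ⟨z, h2, h1⟩
  change s ∈ closure _
  rw [mem_closure_iff_nhds]
  intro O hO
  have hO' : {y | s - y ∈ O} ∈ nhds (0 : G) := by
    have hcont : Filter.Tendsto (fun y => s - y) (nhds 0) (nhds s) := by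
      have : Continuous fun y => s - y := by fun_prop
      simpa using this.tendsto 0
    exact hcont hO
  obtain ⟨U, hUo, -, hU⟩ := exists_isOpen_isCompact_addSubgroup hO'
  obtain ⟨m, hm, hmU⟩ := exists_nsmul_mem_of_isCompact hK hUo hc
  obtain ⟨a, r, hr, rfl⟩ := Nat.exists_eq_pow_mul_and_not_dvd hm.ne' q hq.ne_one
  obtain ⟨z, hz, hzU⟩ := approx _ (hs a) U hUo
  obtain ⟨k, rfl⟩ := AddSubgroup.mem_zmultiples_iff.mp hz
  have hrs : (r : ℤ) • s ∈ U := by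
    have h1 : (r : ℤ) • (s - k • (q ^ a : ℤ) • c) ∈ U := U.zsmul_mem hzU _
    have h2 : k • ((q ^ a * r : ℕ) • c) ∈ U := U.zsmul_mem hmU _
    have h3 : (r : ℤ) • s = (r : ℤ) • (s - k • (q ^ a : ℤ) • c) + k • ((q ^ a * r : ℕ) • c) := by
      rw [← natCast_zsmul c (q ^ a * r)]
      push_cast
      module
    rw [h3]; exact add_mem h1 h2
  have hcop : IsCoprime (r : ℤ) (q : ℤ) := by
    rw [Nat.isCoprime_iff_coprime]
    exact ((Nat.Prime.coprime_iff_not_dvd hq).mpr hr).symm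
  obtain ⟨u, v, huv⟩ := hcop
  refine ⟨v • (q : ℤ) • s, ?_, AddSubgroup.zsmul_mem _ (AddSubgroup.mem_zmultiples _) v⟩
  have h4 : s - v • (q : ℤ) • s ∈ U := by
    have : s - v • (q : ℤ) • s = u • (r : ℤ) • s := by
      rw [smul_smul, smul_smul, eq_sub_of_add_eq huv, sub_smul, one_smul]
    rw [this]; exact U.zsmul_mem hrs u
  have := hU h4
  simpa using this

omit [LocallyCompactSpace G] [T2Space G] [TotallyDisconnectedSpace G] in
/-- In a compact abelian group every element splits into a `p`-divisible and a `q`-divisible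
part, inside the closed subgroup it generates. -/
theorem exists_eq_add_of_mem_isCompact {K : AddSubgroup G} (hK : IsCompact (K : Set G))
    {c : G} (hc : c ∈ K) {p q : ℕ} (hpq : p.Coprime q) :
    ∃ s ∈ K, (∀ n : ℕ, s ∈ (AddSubgroup.zmultiples ((p ^ n : ℤ) • c)).topologicalClosure) ∧
      ∀ n : ℕ, c - s ∈ (AddSubgroup.zmultiples ((q ^ n : ℤ) • c)).topologicalClosure := by
  have hbez : ∀ n : ℕ, ∃ u v : ℤ, u * p ^ n + v * q ^ n = 1 := fun n =>
    (Nat.isCoprime_iff_coprime.mpr hpq).pow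
  choose u v huv using hbez
  -- By Bézout, `c` is the sum of `u n * p ^ n • c` and `v n * q ^ n • c`; a cluster point `s` of
  -- the first terms makes `c - s` one of the second.
  obtain ⟨s, hsK, hs⟩ := hK.exists_mapClusterPt (f := Filter.atTop)
    (u := fun n : ℕ => (u n * p ^ n : ℤ) • c)
    (Filter.tendsto_principal.mpr (Filter.Eventually.of_forall fun n => K.zsmul_mem hc _))
  refine ⟨s, hsK, fun n => ?_, fun n => ?_⟩
  · refine (AddSubgroup.isClosed_topologicalClosure _).mem_of_mapClusterPt hs ?_
    filter_upwards [Filter.eventually_ge_atTop n] with m hm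
    refine AddSubgroup.le_topologicalClosure _ (AddSubgroup.mem_zmultiples_iff.mpr
      ⟨u m * p ^ (m - n), ?_⟩)
    rw [smul_smul, mul_assoc, ← pow_add, Nat.sub_add_cancel hm]
  · have hcont : Continuous fun y : G => c - y := by fun_prop
    refine ((AddSubgroup.isClosed_topologicalClosure _).preimage hcont).mem_of_mapClusterPt hs ?_
    filter_upwards [Filter.eventually_ge_atTop n] with m hm
    refine AddSubgroup.le_topologicalClosure _ (AddSubgroup.mem_zmultiples_iff.mpr
      ⟨v m * q ^ (m - n), ?_⟩)
    rw [smul_smul, mul_assoc, ← pow_add, Nat.sub_add_cancel hm,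
      eq_sub_iff_add_eq'.mpr (huv m), sub_smul, one_smul]

omit [LocallyCompactSpace G] [TotallyDisconnectedSpace G] in
-- Otherwise test modularity on `A = ℤqx`, `B = ℤ(x + c)`, `C = ℤx`. Since `c` has infinite order,
-- `B ∩ C = 0`. But `qc ∈ A + B`, so `c`, and with it `x = (x + c) - c`, lies in the closure of `A +
-- B`. This forces `x ∈ ℤqx`, which is absurd.
theorem TopologicallyModular.notMem_closure_zmultiples (h : TopologicallyModular G)
    (ho : IsOpen (compSubgroup G : Set G)) {x : G} (hx : x ∉ compSubgroup G) {c : G}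
    (hc : c ∈ compSubgroup G) (hfin : ¬ IsOfFinAddOrder c) {q : ℕ} (hq : q.Prime) :
    c ∉ (AddSubgroup.zmultiples ((q : ℤ) • c)).topologicalClosure := by
  intro hcq
  have hclosed : ∀ k ∈ compSubgroup G, ∀ n : ℤ, n ≠ 0 →
      IsClosed (AddSubgroup.zmultiples (n • (x + k)) : Set G) := by
    intro k hk n hn
    refine AddSubgroup.isClosed_of_disjoint ho ?_
    rintro y hy hyc
    obtain ⟨m, rfl⟩ := AddSubgroup.mem_zmultiples_iff.mp hy
    rw [smul_smul, smul_add] at hyc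
    have h1 : (m * n) • x ∈ compSubgroup G := by
      simpa using sub_mem hyc (AddSubgroup.zsmul_mem _ hk (m * n))
    have h2 := eq_zero_of_zsmul_mem_compSubgroup hx h1
    rw [smul_smul, h2, zero_smul]
  have hq0 : (q : ℤ) ≠ 0 := by exact_mod_cast hq.ne_zero
  have hA := hclosed 0 (zero_mem _) q hq0
  have hC := hclosed 0 (zero_mem _) 1 one_ne_zero
  have hB := hclosed c hc 1 one_ne_zero
  simp only [one_smul, add_zero] at hA hB hC
  have hmem : x ∈ AddSubgroup.zmultiples ((q : ℤ) • x) := by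
    refine h.mem hA hB hC hA ?_ le_rfl ?_ (AddSubgroup.mem_zmultiples x) ?_
    · rw [AddSubgroup.zmultiples_le]
      exact AddSubgroup.zsmul_mem _ (AddSubgroup.mem_zmultiples x) _
    · rintro y ⟨hy1, hy2⟩
      obtain ⟨m, rfl⟩ := AddSubgroup.mem_zmultiples_iff.mp hy1
      obtain ⟨k, hk⟩ := AddSubgroup.mem_zmultiples_iff.mp hy2
      have hk : k • x = m • (x + c) := hk
      have h1 : (k - m) • x ∈ compSubgroup G := by
        have : (k - m) • x = m • c := by rw [sub_smul, hk, smul_add, add_sub_cancel_left]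
        rw [this]; exact AddSubgroup.zsmul_mem _ hc m
      have h2 : k = m := sub_eq_zero.mp (eq_zero_of_zsmul_mem_compSubgroup hx h1)
      subst h2
      have h3 : k • c = 0 := by simpa [smul_add] using hk
      have h4 : k = 0 := by
        by_contra hne
        exact hfin (isOfFinAddOrder_iff_zsmul_eq_zero.mpr ⟨k, hne, h3⟩)
      simp [h4]
    · have h1 : AddSubgroup.zmultiples ((q : ℤ) • c) ≤
          AddSubgroup.zmultiples ((q : ℤ) • x) ⊔ AddSubgroup.zmultiples (x + c) := by
        rw [AddSubgroup.zmultiples_le]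
        have : (q : ℤ) • c = -((q : ℤ) • x) + (q : ℤ) • (x + c) := by module
        rw [this]
        exact AddSubgroup.add_mem_sup (neg_mem (AddSubgroup.mem_zmultiples _))
          (AddSubgroup.zsmul_mem _ (AddSubgroup.mem_zmultiples _) _)
      have h2 := AddSubgroup.topologicalClosure_mono h1 hcq
      have h3 : x + c ∈ (AddSubgroup.zmultiples ((q : ℤ) • x) ⊔
          AddSubgroup.zmultiples (x + c)).topologicalClosure :=
        AddSubgroup.le_topologicalClosure _
          (AddSubgroup.mem_sup_right (AddSubgroup.mem_zmultiples _))
      simpa using sub_mem h3 h2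
  obtain ⟨k, hk⟩ := AddSubgroup.mem_zmultiples_iff.mp hmem
  have h1 : (k * q - 1) • x ∈ compSubgroup G := by
    have : (k * q - 1) • x = 0 := by
      rw [sub_smul, ← smul_smul, hk, one_smul, sub_self]
    rw [this]; exact zero_mem _
  have h2 := eq_zero_of_zsmul_mem_compSubgroup hx h1
  have h3 : (q : ℤ) ∣ 1 := ⟨k, by linarith⟩
  have := hq.two_le
  have := Int.le_of_dvd one_pos h3
  omega

/-- Split `c` into a 2-divisible and a 3-divisible part; any two distinct primes would do. Each part
`s` lies in the closure of `ℤqs` for its prime `q`, so it cannot have infinite order. -/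
theorem TopologicallyModular.compSubgroup_le_torsion (h : TopologicallyModular G)
    {x : G} (hx : x ∉ compSubgroup G) : compSubgroup G ≤ AddCommGroup.torsion G := by
  rintro c ⟨K, hK, hc⟩
  have tors : ∀ s ∈ K, ∀ q : ℕ, q.Prime →
      (∀ n : ℕ, s ∈ (AddSubgroup.zmultiples ((q ^ n : ℤ) • c)).topologicalClosure) →
      s ∈ AddCommGroup.torsion G := by
    intro s hs q hq hsq
    by_contra hfin
    exact h.notMem_closure_zmultiples isOpen_compSubgroup hx ⟨K, hK, hs⟩ hfin hq
      (mem_closure_zmultiples_smul_of_divisible hK hc hq hsq)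
  obtain ⟨s, hs, h2, h3⟩ := exists_eq_add_of_mem_isCompact hK hc (p := 2) (q := 3) (by norm_num)
  have : s + (c - s) ∈ AddCommGroup.torsion G := AddSubgroup.add_mem _ (tors s hs 2 Nat.prime_two h2)
    (tors _ (sub_mem hc hs) 3 Nat.prime_three h3)
  rwa [add_sub_cancel] at this

omit [LocallyCompactSpace G] [T2Space G] [TotallyDisconnectedSpace G] in
/-- If some element of `G` has infinite order modulo the open subgroup `T`, then sums of closed subgroups
inside `T` are closed. -/
theorem TopologicallyModular.isClosed_sup (h : TopologicallyModular G) {T : AddSubgroup G}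
    (hT : IsOpen (T : Set G)) {x : G} (hx : ∀ m : ℤ, m • x ∈ T → m = 0) {X Y : AddSubgroup G}
    (hX : IsClosed (X : Set G)) (hY : IsClosed (Y : Set G)) (hXT : X ≤ T) (hYT : Y ≤ T) :
    IsClosed ((X ⊔ Y : AddSubgroup G) : Set G) := by
  have hTc : IsClosed (T : Set G) := T.isClosed_of_isOpen hT
  refine isClosed_of_closure_subset fun u hu => ?_
  have hu' : u ∈ (X ⊔ Y).topologicalClosure := hu
  have huT : u ∈ T := AddSubgroup.topologicalClosure_minimal _ (sup_le hXT hYT) hTc hu'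
  -- a closed subgroup of `T` plus a group of multiples of a translate of `x` is closed
  have hclosed : ∀ Z : AddSubgroup G, IsClosed (Z : Set G) → Z ≤ T → ∀ t ∈ T,
      ∀ W ≤ AddSubgroup.zmultiples (x + t), IsClosed ((Z ⊔ W : AddSubgroup G) : Set G) := by
    intro Z hZ hZT t ht W hW
    refine AddSubgroup.isClosed_of_isClosed_inf hT ?_
    have : (Z ⊔ W) ⊓ T = Z := by
      refine le_antisymm ?_ (le_inf le_sup_left hZT)
      rintro y ⟨hy, hyT⟩
      obtain ⟨z, hz, w, hw, rfl⟩ := AddSubgroup.mem_sup.mp hy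
      obtain ⟨m, rfl⟩ := AddSubgroup.mem_zmultiples_iff.mp (hW hw)
      have hyT : z + m • (x + t) ∈ T := hyT
      have h1 : m • x ∈ T := by
        have h2 := sub_mem (sub_mem hyT (hZT hz)) (AddSubgroup.zsmul_mem _ ht m)
        simpa [smul_add] using h2
      rw [hx m h1, zero_smul, add_zero]; exact hz
    rw [this]; exact hZ
  -- `M` records the `m` with `m • u ∈ X + Y`; the aim is `1 ∈ M`. With `A = X`, `B = Y + ℤ(x - u)`,
  -- `C = X + ℤx`, comparing coefficients of `x` modulo `T` gives `B ∩ C ≤ X + Mx`, while `x = (x -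
  -- u) + u` lies in the closure of `A + B`.
  let M : AddSubgroup ℤ := (X ⊔ Y).comap (zmultiplesHom G u)
  let W : AddSubgroup G := M.map (zmultiplesHom G x)
  have hWle : W ≤ AddSubgroup.zmultiples x := by
    rintro _ ⟨m, -, rfl⟩
    exact AddSubgroup.mem_zmultiples_iff.mpr ⟨m, rfl⟩
  have hmem : x ∈ X ⊔ W := by
    refine h.mem (A := X) (B := Y ⊔ AddSubgroup.zmultiples (x + -u))
      (C := X ⊔ AddSubgroup.zmultiples x) hX
      (hclosed Y hY hYT (-u) (neg_mem huT) _ le_rfl)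
      (hclosed X hX hXT 0 (zero_mem _) _ (by simp))
      (hclosed X hX hXT 0 (zero_mem _) _ (by simpa using hWle)) le_sup_left le_sup_left ?_
      (AddSubgroup.mem_sup_right (AddSubgroup.mem_zmultiples x)) ?_
    · rintro b ⟨hb1, hb2⟩
      obtain ⟨y, hy, w, hw, rfl⟩ := AddSubgroup.mem_sup.mp hb1
      obtain ⟨m, rfl⟩ := AddSubgroup.mem_zmultiples_iff.mp hw
      obtain ⟨x', hx', w, hw, he⟩ := AddSubgroup.mem_sup.mp hb2
      obtain ⟨k, rfl⟩ := AddSubgroup.mem_zmultiples_iff.mp hw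
      have h1 : (k - m) • x = y - m • u - x' := by
        have h1' : k • x = y + m • (x + -u) - x' := by rw [← he]; abel
        rw [sub_smul, h1', smul_add, smul_neg]; abel
      have h2 : k = m := by
        refine sub_eq_zero.mp (hx _ ?_)
        rw [h1]
        exact sub_mem (sub_mem (hYT hy) (AddSubgroup.zsmul_mem _ huT m)) (hXT hx')
      subst h2
      rw [← he]
      refine AddSubgroup.add_mem_sup hx' ⟨k, ?_, rfl⟩
      change k • u ∈ X ⊔ Y
      have h3 : k • u = -x' + y := by
        rw [sub_self, zero_smul] at h1
        have : k • u = y - (y - k • u - x') - x' := by abel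
        rw [this, ← h1]; abel
      rw [h3]
      exact AddSubgroup.add_mem_sup (neg_mem hx') hy
    · have h1 : u ∈ (X ⊔ (Y ⊔ AddSubgroup.zmultiples (x + -u))).topologicalClosure :=
        AddSubgroup.topologicalClosure_mono (sup_le_sup_left le_sup_left X) hu'
      have h2 : x + -u ∈ (X ⊔ (Y ⊔ AddSubgroup.zmultiples (x + -u))).topologicalClosure :=
        AddSubgroup.le_topologicalClosure _ (AddSubgroup.mem_sup_right
          (AddSubgroup.mem_sup_right (AddSubgroup.mem_zmultiples _)))
      simpa using add_mem h2 h1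
  obtain ⟨x', hx', w, ⟨k, hk, rfl⟩, he⟩ := AddSubgroup.mem_sup.mp hmem
  have he : x' + k • x = x := he
  have h1 : k - 1 = 0 := by
    apply hx
    have : (k - 1) • x = -x' := by
      rw [sub_smul, one_smul]; nth_rewrite 2 [← he]; abel
    rw [this]; exact neg_mem (hXT hx')
  have h2 : k = 1 := by omega
  subst h2
  have hk : (1 : ℤ) • u ∈ X ⊔ Y := hk
  simpa using hk

end ModularConsequences

/-! ### Finite rank and finiteness of quotients by multiples. -/

section Rank

theorem zRank_eq_rank (A : Type*) [AddCommGroup A] : zRank A = Module.rank ℤ A := by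
  have := (isLocalizedModule_iff_isBaseChange (nonZeroDivisors ℤ) ℚ
    (TensorProduct.mk ℤ ℚ A 1)).mpr (TensorProduct.isBaseChange ℤ A ℚ)
  have h2 := IsLocalizedModule.rank_eq (nonZeroDivisors ℤ) le_rfl (TensorProduct.mk ℤ ℚ A 1)
  exact (IsLocalization.rank_eq ℚ (nonZeroDivisors ℤ) le_rfl).trans h2

/-- A torsion-free abelian group of finite rank has finite quotients modulo its multiples. -/
theorem finite_quotient_nsmul_of_rank_lt_aleph0 (D : Type*) [AddCommGroup D] [IsAddTorsionFree D]
    (hD : Module.rank ℤ D < Cardinal.aleph0) {n : ℕ} (hn : 0 < n) :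
    Finite (D ⧸ (nsmulAddMonoidHom n : D →+ D).range) := by
  by_contra hinf
  rw [not_finite_iff_infinite] at hinf
  -- Representatives of these cosets generate a free group of rank at most `finrank ℤ D`, so one
  -- more than `n ^ finrank` of them forces two to agree in all coordinates modulo `n`.
  obtain ⟨s, hs⟩ := Infinite.exists_subset_card_eq
    (D ⧸ (nsmulAddMonoidHom n : D →+ D).range) (n ^ Module.finrank ℤ D + 1)
  let F : Submodule ℤ D := Submodule.span ℤ ((fun y : D ⧸ (nsmulAddMonoidHom n : D →+ D).range =>
    Quotient.out y) '' (s : Set _))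
  have : Module.Finite ℤ F := Module.Finite.span_of_finite ℤ (s.finite_toSet.image _)
  have : Module.Free ℤ F := inferInstance
  let b := Module.finBasis ℤ F
  have hrank : Module.finrank ℤ F ≤ Module.finrank ℤ D :=
    Cardinal.toNat_le_toNat (Submodule.rank_le F) hD
  have : NeZero n := ⟨hn.ne'⟩
  let g : s → (Fin (Module.finrank ℤ F) → ZMod n) := fun y i =>
    (b.repr ⟨Quotient.out y.1, Submodule.subset_span ⟨y.1, y.2, rfl⟩⟩ i : ZMod n)
  have hcard : Fintype.card (Fin (Module.finrank ℤ F) → ZMod n) < Fintype.card s := by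
    rw [Fintype.card_coe, hs, Fintype.card_fun, ZMod.card, Fintype.card_fin]
    exact Nat.lt_succ_of_le (Nat.pow_le_pow_right hn hrank)
  obtain ⟨y, z, hyz, hg⟩ := Fintype.exists_ne_map_eq_of_card_lt g hcard
  apply hyz
  apply Subtype.ext
  set y' : F := ⟨Quotient.out y.1, Submodule.subset_span ⟨y.1, y.2, rfl⟩⟩ with hy'
  set z' : F := ⟨Quotient.out z.1, Submodule.subset_span ⟨z.1, z.2, rfl⟩⟩ with hz'
  have hdiv : ∀ i, ∃ k : ℤ, b.repr z' i - b.repr y' i = n * k := fun i =>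
    (ZMod.intCast_eq_intCast_iff_dvd_sub _ _ n).mp (congrFun hg i)
  choose k hk using hdiv
  have hsub : z' - y' = n • ∑ i, k i • b i := by
    apply b.ext_elem
    intro i
    simp [hk, Finsupp.single_apply]
  rw [← Quotient.out_eq y.1, ← Quotient.out_eq z.1]
  refine (QuotientAddGroup.eq).mpr ⟨((∑ i, k i • b i : F) : D), ?_⟩
  have := congrArg Subtype.val hsub
  simp only [nsmulAddMonoidHom_apply]
  rw [neg_add_eq_sub]
  simpa using this.symm

/-- `β` factors through `α.range` and, being killed by `n`, through the finite group `α.range / n`.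
-/
theorem finite_range_of_ker_le {L Q W : Type*} [AddCommGroup L] [AddCommGroup Q] [AddCommGroup W]
    [IsAddTorsionFree Q] (hQ : Module.rank ℤ Q < Cardinal.aleph0) (α : L →+ Q) (β : L →+ W)
    (hαβ : α.ker ≤ β.ker) {n : ℕ} (hn : 0 < n) (hβ : ∀ l, n • β l = 0) :
    (Set.range β).Finite := by
  have hrank : Module.rank ℤ α.range < Cardinal.aleph0 :=
    (Submodule.rank_le (AddSubgroup.toIntSubmodule α.range)).trans_lt hQ
  have := finite_quotient_nsmul_of_rank_lt_aleph0 α.range hrank hn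
  let π : L → α.range ⧸ (nsmulAddMonoidHom n : α.range →+ α.range).range :=
    fun l => QuotientAddGroup.mk (α.rangeRestrict l)
  have hπ : ∀ l l', π l = π l' → β l = β l' := by
    intro l l' h
    obtain ⟨⟨_, d, rfl⟩, hd⟩ := QuotientAddGroup.eq.mp h
    have h1 : n • α d = -α l + α l' := congrArg Subtype.val hd
    have h2 : -l + l' - n • d ∈ β.ker := hαβ (by simp [AddMonoidHom.mem_ker, h1])
    have h3 : -β l + β l' - n • β d = 0 := by simpa [AddMonoidHom.mem_ker] using h2
    rw [hβ, sub_zero, neg_add_eq_zero] at h3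
    exact h3
  have hfin : (Set.range π).Finite := Set.toFinite _
  refine Set.Finite.of_surjOn (f := fun p => β (Function.invFun π p)) (s := Set.univ) ?_
    Set.finite_univ
  rintro _ ⟨l, rfl⟩
  exact ⟨π l, trivial, hπ _ _ (Function.invFun_eq ⟨l, rfl⟩)⟩

theorem exists_linearIndependent_nat_of_aleph0_le_rank {A : Type*} [AddCommGroup A]
    (h : Cardinal.aleph0 ≤ Module.rank ℤ A) : ∃ x : ℕ → A, LinearIndependent ℤ x := by
  obtain ⟨s, hs, hli⟩ := exists_set_linearIndependent ℤ A
  rw [← hs] at h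
  have : Infinite s := Cardinal.infinite_iff.mpr h
  let e := Infinite.natEmbedding s
  exact ⟨fun n => (e n : A), hli.comp e e.injective⟩

end Rank

/-! ### Modularity forces finite rank. -/

section FiniteRank

variable {G : Type*} [AddCommGroup G] [TopologicalSpace G] [IsTopologicalAddGroup G]

/-- A countable compact Hausdorff group is finite. -/
theorem AddSubgroup.finite_of_countable_of_isCompact [T2Space G] {H : AddSubgroup G}
    (hH : IsCompact (H : Set G)) (hcount : Countable H) : Finite H := by
  have : CompactSpace H := isCompact_iff_compactSpace.mp hH
  -- By Baire some singleton has interior, so `H` is discrete as well as compact.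
  obtain ⟨x, y, hy⟩ := nonempty_interior_of_iUnion_of_closed (X := H) (f := fun x : H => {x})
    (fun _ => isClosed_singleton) (by ext; simp)
  have hbot : IsOpen ((⊥ : AddSubgroup H) : Set H) := by
    have hxy : y = x := (Set.mem_singleton_iff.mp (interior_subset (s := {x}) hy))
    have h1 : ({x} : Set H) ∈ nhds x := by
      rw [← hxy] at hy ⊢
      exact mem_interior_iff_mem_nhds.mp hy
    have h2 : IsOpen ({x} : Set H) := by
      rw [isOpen_iff_mem_nhds]; rintro z rfl; exact h1
    have h3 := h2.preimage (continuous_const.add continuous_id : Continuous fun z : H => x + z)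
    convert h3 using 1
    ext z; simp
  have : DiscreteTopology H :=
    discreteTopology_of_isOpen_singleton_zero (by simpa using hbot)
  exact finite_of_compact_of_discrete

/-- Infinite rank gives `x i` independent modulo `T`, and non-discreteness gives an infinite compact
open `U ≤ T` with a countable non-closed subgroup `H`. Attaching a limit `u₀ ∉ H` to `x 0` and
generators of `H` to the other `x i` produces discrete subgroups that violate modularity. -/
theorem TopologicallyModular.rank_lt_aleph0 [LocallyCompactSpace G] [T2Space G]
    [TotallyDisconnectedSpace G] (hdisc : ¬ DiscreteTopology G) (h : TopologicallyModular G)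
    {T : AddSubgroup G} (hT : IsOpen (T : Set G)) :
    Module.rank ℤ (G ⧸ T) < Cardinal.aleph0 := by
  by_contra hrank
  obtain ⟨x', hx'⟩ := exists_linearIndependent_nat_of_aleph0_le_rank (not_lt.mp hrank)
  choose x hx using fun i => QuotientAddGroup.mk'_surjective T (x' i)
  obtain ⟨U, hUo, hUc, hUT⟩ := exists_isOpen_isCompact_addSubgroup (hT.mem_nhds T.zero_mem)
  have hUinf : Infinite U := by
    by_contra hfin
    rw [not_infinite_iff_finite] at hfin
    apply hdisc
    refine discreteTopology_of_isOpen_singleton_zero ?_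
    have hf : ((U : Set G) \ {0}).Finite := (Set.toFinite (U : Set G)).subset Set.sdiff_subset
    have : ({0} : Set G) = (U : Set G) \ ((U : Set G) \ {0}) := by
      simp [U.zero_mem]
    rw [this]
    exact hUo.sdiff hf.isClosed
  let g := Infinite.natEmbedding U
  let H : AddSubgroup G := AddSubgroup.closure (Set.range fun n => (g n : G))
  have hHU : H ≤ U := by
    rw [AddSubgroup.closure_le]; rintro _ ⟨n, rfl⟩; exact (g n).2
  have hHnc : ¬ IsClosed (H : Set G) := by
    intro hcl
    have hcount : Countable H := by
      have hle : H ≤ (Finsupp.linearCombination ℤ fun n => (g n : G)).toAddMonoidHom.range := by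
        rw [AddSubgroup.closure_le]
        rintro _ ⟨n, rfl⟩
        exact ⟨Finsupp.single n 1, by simp⟩
      exact ((Set.countable_range _).mono hle).to_subtype
    have := AddSubgroup.finite_of_countable_of_isCompact (hUc.of_isClosed_subset hcl hHU) hcount
    have hinj : Function.Injective fun n : ℕ =>
        (⟨g n, AddSubgroup.subset_closure ⟨n, rfl⟩⟩ : H) := by
      intro a b hab
      exact g.injective (Subtype.ext (Subtype.mk.inj hab))
    exact not_injective_infinite_finite _ hinj
  obtain ⟨u₀, hu₀, hu₀H⟩ : ∃ u₀ ∈ closure (H : Set G), u₀ ∉ H := by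
    by_contra! hcon
    exact hHnc (isClosed_of_closure_subset hcon)
  have hu₀T : u₀ ∈ T :=
    hUT (closure_minimal hHU hUc.isClosed hu₀)
  -- Index `0` carries the limit point and index `n + 1` the generator `g n`.
  let u : ℕ → G := fun i => Nat.casesOn i u₀ fun n => (g n : G)
  have huT : ∀ i, u i ∈ T := by
    rintro (_ | n)
    · exact hu₀T
    · exact hUT (g n).2
  let φ : (ℕ →₀ ℤ) →+ G := (Finsupp.linearCombination ℤ x).toAddMonoidHom
  let ψ : (ℕ →₀ ℤ) →+ G := (Finsupp.linearCombination ℤ u).toAddMonoidHom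
  have hφ1 : ∀ i, φ (Finsupp.single i 1) = x i := fun i => by simp [φ]
  have hψ1 : ∀ i, ψ (Finsupp.single i 1) = u i := fun i => by simp [ψ]
  have hψT : ∀ z, ψ z ∈ T := fun z => by
    change Finsupp.linearCombination ℤ u z ∈ T
    rw [Finsupp.linearCombination_apply]
    exact AddSubgroup.sum_mem _ fun i _ => T.zsmul_mem (huT i) _
  have hφ0 : ∀ z, φ z ∈ T → z = 0 := by
    intro z hz
    refine (linearIndependent_iff.mp hx') z ?_
    have h1 : Finsupp.linearCombination ℤ x' z = QuotientAddGroup.mk' T (φ z) := by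
      have : x' = fun i => QuotientAddGroup.mk' T (x i) := funext fun i => (hx i).symm
      change _ = QuotientAddGroup.mk' T (Finsupp.linearCombination ℤ x z)
      rw [this, Finsupp.linearCombination_apply, Finsupp.linearCombination_apply,
        Finsupp.sum, Finsupp.sum, map_sum]
      simp
    rw [h1]
    exact (QuotientAddGroup.eq_zero_iff _).mpr hz
  have hclosed : ∀ P : (ℕ →₀ ℤ) →+ G, (∀ z, P z ∈ T → z = 0) → ∀ E : AddSubgroup (ℕ →₀ ℤ),
      IsClosed (E.map P : Set G) := by
    intro P hP E
    refine AddSubgroup.isClosed_of_disjoint hT ?_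
    rintro _ ⟨z, -, rfl⟩ hz
    rw [hP z hz, map_zero]
  have hφψ0 : ∀ z, (φ + ψ) z ∈ T → z = 0 := fun z hz =>
    hφ0 z (by simpa using sub_mem (show φ z + ψ z ∈ T from hz) (hψT z))
  let E : AddSubgroup (ℕ →₀ ℤ) := (Finsupp.applyAddHom 0).ker
  -- Here `A = φ(E)`, `B` is the image of `φ + ψ` and `C` that of `φ`, so `B ∩ C = φ(ker ψ)`. Each
  -- `g n` lies in `A + B`, hence `u₀` and `x 0 = (x 0 + u₀) - u₀` lie in its closure. By
  -- injectivity of `φ` the conclusion gives `u₀ ∈ ψ(E) ≤ H`.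
  have hmem : x 0 ∈ (ψ.ker ⊔ E).map φ := by
    refine h.mem (A := E.map φ) (B := (⊤ : AddSubgroup _).map (φ + ψ))
      (C := (⊤ : AddSubgroup _).map φ)
      (hclosed _ hφ0 _) (hclosed _ hφψ0 _) (hclosed _ hφ0 _) (hclosed _ hφ0 _)
      (AddSubgroup.map_mono le_top) (AddSubgroup.map_mono le_sup_right) ?_
      ⟨Finsupp.single 0 1, trivial, hφ1 0⟩ ?_
    · rintro _ ⟨⟨z, -, rfl⟩, ⟨w, -, hw⟩⟩
      have hw : φ w = φ z + ψ z := hw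
      have h1 : w - z = 0 := hφ0 _ (by rw [map_sub, hw, add_sub_cancel_left]; exact hψT z)
      have h2 : w = z := sub_eq_zero.mp h1
      subst h2
      have h3 : ψ w = 0 := by simpa using hw
      exact ⟨w, AddSubgroup.mem_sup_left h3, by simp [h3]⟩
    · have h1 : H ≤ E.map φ ⊔ (⊤ : AddSubgroup _).map (φ + ψ) := by
        rw [AddSubgroup.closure_le]
        rintro _ ⟨n, rfl⟩
        have h2 : (g n : G) = -φ (Finsupp.single (n + 1) 1) +
            (φ + ψ) (Finsupp.single (n + 1) 1) := by
          rw [AddMonoidHom.add_apply, hψ1, neg_add_cancel_left]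
        change (g n : G) ∈ _
        rw [h2]
        refine AddSubgroup.add_mem_sup (neg_mem ⟨_, ?_, rfl⟩) ⟨_, trivial, rfl⟩
        simp [E, AddMonoidHom.mem_ker]
      have h2 : u₀ ∈ (E.map φ ⊔ (⊤ : AddSubgroup _).map (φ + ψ)).topologicalClosure :=
        AddSubgroup.topologicalClosure_mono h1 hu₀
      have h3 : (φ + ψ) (Finsupp.single 0 1) ∈
          (E.map φ ⊔ (⊤ : AddSubgroup _).map (φ + ψ)).topologicalClosure :=
        AddSubgroup.le_topologicalClosure _ (AddSubgroup.mem_sup_right ⟨_, trivial, rfl⟩)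
      have h4 : x 0 = (φ + ψ) (Finsupp.single 0 1) - u₀ := by
        rw [AddMonoidHom.add_apply, hφ1, hψ1]; exact (add_sub_cancel_right _ u₀).symm
      rw [h4]; exact sub_mem h3 h2
  obtain ⟨z, hz, hzx⟩ := hmem
  obtain ⟨k, hk, e, he, rfl⟩ := AddSubgroup.mem_sup.mp hz
  have h1 : k + e = Finsupp.single 0 1 := by
    refine sub_eq_zero.mp (hφ0 _ ?_)
    rw [map_sub, hzx, hφ1, sub_self]; exact T.zero_mem
  apply hu₀H
  have h2 : u₀ = ψ e := by
    have h3 : ψ (k + e) = u₀ := by rw [h1]; exact hψ1 0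
    rw [← h3, map_add, (show ψ k = 0 from hk), zero_add]
  rw [h2]
  change Finsupp.linearCombination ℤ u e ∈ H
  rw [Finsupp.linearCombination_apply]
  refine AddSubgroup.sum_mem _ fun i hi => H.zsmul_mem ?_ _
  rcases i with _ | n
  · exact absurd (show e 0 = 0 from he) (Finsupp.mem_support_iff.mp hi)
  · exact AddSubgroup.subset_closure ⟨n, rfl⟩

end FiniteRank

/-! ### From the structure of `T` to closed sums; quotients by `N ≤ T`. -/

section StructureTheorem

variable {G : Type*} [AddCommGroup G] [TopologicalSpace G] [IsTopologicalAddGroup G]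

omit [IsTopologicalAddGroup G] in
theorem stronglyTopologicallyQuasihamiltonian_iff :
    StronglyTopologicallyQuasihamiltonian G ↔ ∀ X Y : AddSubgroup G, IsClosed (X : Set G) →
      IsClosed (Y : Set G) → IsClosed ((X ⊔ Y : AddSubgroup G) : Set G) := by
  simp only [StronglyTopologicallyQuasihamiltonian, AddSubgroup.add_normal]

omit [IsTopologicalAddGroup G] in
/-- For a closed subgroup `T`, the condition on `T` only involves closed subgroups of `G`. -/
theorem stronglyTopologicallyQuasihamiltonian_addSubgroup_iff {T : AddSubgroup G}
    (hT : IsClosed (T : Set G)) :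
    StronglyTopologicallyQuasihamiltonian T ↔ ∀ X Y : AddSubgroup G, IsClosed (X : Set G) →
      IsClosed (Y : Set G) → X ≤ T → Y ≤ T → IsClosed ((X ⊔ Y : AddSubgroup G) : Set G) := by
  have hemb : Topology.IsClosedEmbedding ((↑) : T → G) := hT.isClosedEmbedding_subtypeVal
  rw [stronglyTopologicallyQuasihamiltonian_iff]
  constructor
  · intro h X Y hX hY hXT hYT
    have h1 := h (X.addSubgroupOf T) (Y.addSubgroupOf T) (hX.preimage continuous_subtype_val)
      (hY.preimage continuous_subtype_val)
    have h2 := hemb.isClosedMap _ h1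
    have h3 : (((X.addSubgroupOf T ⊔ Y.addSubgroupOf T).map T.subtype : AddSubgroup G) : Set G) =
        (X ⊔ Y : AddSubgroup G) := by
      rw [AddSubgroup.map_sup, AddSubgroup.addSubgroupOf_map_subtype,
        AddSubgroup.addSubgroupOf_map_subtype, inf_eq_left.mpr hXT, inf_eq_left.mpr hYT]
    rw [← h3]; exact h2
  · intro h X Y hX hY
    have h1 := h (X.map T.subtype) (Y.map T.subtype) (hemb.isClosedMap _ hX)
      (hemb.isClosedMap _ hY) (AddSubgroup.map_subtype_le X) (AddSubgroup.map_subtype_le Y)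
    rw [← AddSubgroup.map_sup] at h1
    exact (hemb.isClosed_iff_image_isClosed).mpr h1

/-- A locally compact torsion group has an open subgroup of bounded exponent. -/
theorem exists_isOpen_addSubgroup_nsmul_eq_zero [LocallyCompactSpace G] [T2Space G]
    {T : AddSubgroup G} (hT : IsOpen (T : Set G)) (htor : T ≤ AddCommGroup.torsion G) :
    ∃ V : AddSubgroup G, IsOpen (V : Set G) ∧ ∃ n : ℕ, 0 < n ∧ ∀ v ∈ V, n • v = 0 := by
  have : LocallyCompactSpace T := hT.locallyCompactSpace
  -- Baire: these closed subgroups cover `T`, so one has interior. The shift keeps the exponent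
  -- positive.
  let f : ℕ → Set T := fun n => {t | (n + 1) • (t : G) = 0}
  have hf : ∀ n, IsClosed (f n) := fun n =>
    isClosed_eq (continuous_subtype_val.nsmul (n + 1)) continuous_const
  have hU : ⋃ n, f n = Set.univ := by
    ext t
    obtain ⟨n, hn, h⟩ := isOfFinAddOrder_iff_nsmul_eq_zero.mp (show IsOfFinAddOrder (t : G) from
      htor t.2)
    simp only [Set.mem_iUnion, Set.mem_univ, iff_true]
    exact ⟨n - 1, by simpa [f, Nat.sub_add_cancel hn] using h⟩
  obtain ⟨n, t, ht⟩ := nonempty_interior_of_iUnion_of_closed hf hU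
  refine ⟨(nsmulAddMonoidHom (n + 1) : G →+ G).ker, ?_, n + 1, n.succ_pos, fun v hv => hv⟩
  refine AddSubgroup.isOpen_of_mem_nhds _ (g := (t : G)) ?_
  have h1 := hT.isOpenMap_subtype_val.image_mem_nhds (mem_interior_iff_mem_nhds.mp ht)
  refine Filter.mem_of_superset h1 ?_
  rintro _ ⟨s, hs, rfl⟩
  exact hs

/-- `S` is the preimage of its image, a finite and so closed subset of the T1 space `G ⧸ N`. -/
theorem AddSubgroup.isClosed_of_finite_map_mk {S N : AddSubgroup G} (hN : IsClosed (N : Set G))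
    (hNS : N ≤ S) (hfin : (QuotientAddGroup.mk' N '' (S : Set G)).Finite) :
    IsClosed (S : Set G) := by
  have : T1Space (G ⧸ N) := inferInstance
  have h1 := hfin.isClosed.preimage (QuotientAddGroup.continuous_mk (N := N))
  convert h1 using 1
  ext y
  constructor
  · exact fun hy => ⟨y, hy, rfl⟩
  · rintro ⟨s, hs, he⟩
    have h2 : -s + y ∈ N := QuotientAddGroup.eq.mp he
    simpa using S.add_mem hs (hNS h2)

theorem ModularStructure.stronglyTopologicallyQuasihamiltonian [LocallyCompactSpace G] [T2Space G]
    {T : AddSubgroup G} (h : ModularStructure G T) : StronglyTopologicallyQuasihamiltonian G := by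
  have hT := h.isOpen
  have hTc := T.isClosed_of_isOpen hT
  have hq := (stronglyTopologicallyQuasihamiltonian_addSubgroup_iff hTc).mp
    h.strongly_quasihamiltonian
  have htf := h.torsionFree_quotient
  have hrank := h.finite_rank_quotient
  rw [zRank_eq_rank] at hrank
  obtain ⟨V, hV, n, hn, hVn⟩ := exists_isOpen_addSubgroup_nsmul_eq_zero hT h.eq_torsion.le
  have hVT : V ≤ T := fun v hv => h.eq_torsion.ge
    (isOfFinAddOrder_iff_nsmul_eq_zero.mpr ⟨n, hn, hVn v hv⟩)
  rw [stronglyTopologicallyQuasihamiltonian_iff]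
  intro X Y hX hY
  let N := X ⊓ T ⊔ Y ⊓ T
  have hN : IsClosed (N : Set G) :=
    hq _ _ (hX.inter hTc) (hY.inter hTc) inf_le_right inf_le_right
  have hNT : N ≤ T := sup_le inf_le_right inf_le_right
  have hPo : IsOpen ((V ⊔ N : AddSubgroup G) : Set G) := AddSubgroup.isOpen_mono le_sup_left hV
  refine AddSubgroup.isClosed_of_isClosed_inf hPo ?_
  refine AddSubgroup.isClosed_of_finite_map_mk hN
    (le_inf (sup_le_sup inf_le_left inf_le_left) le_sup_right) ?_
  let σ : X × Y →+ G := X.subtype.coprod Y.subtype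
  let L : AddSubgroup (X × Y) := (V ⊔ N).comap σ
  -- For `x + y ∈ V + N ≤ T`, `x ∈ T` forces `y ∈ T` and thus `x + y ∈ N`. So the sum modulo `N`
  -- depends only on `x` modulo `T`, and `n` kills it.
  let α : L →+ G ⧸ T := (QuotientAddGroup.mk' T).comp
    (X.subtype.comp ((AddMonoidHom.fst X Y).comp L.subtype))
  let β : L →+ G ⧸ N := (QuotientAddGroup.mk' N).comp (σ.comp L.subtype)
  have hαβ : α.ker ≤ β.ker := by
    rintro ⟨⟨x, y⟩, hl⟩ hα
    have hl : (x : G) + y ∈ V ⊔ N := hl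
    have hx : (x : G) ∈ T := (QuotientAddGroup.eq_zero_iff _).mp hα
    have hy : (y : G) ∈ T := by simpa using sub_mem (sup_le hVT hNT hl) hx
    exact (QuotientAddGroup.eq_zero_iff _).mpr (AddSubgroup.add_mem_sup ⟨x.2, hx⟩ ⟨y.2, hy⟩)
  have hβ : ∀ l, n • β l = 0 := by
    rintro ⟨l, hl⟩
    have hl : σ l ∈ V ⊔ N := hl
    obtain ⟨v, hv, w, hw, he⟩ := AddSubgroup.mem_sup.mp hl
    change n • QuotientAddGroup.mk' N (σ l) = 0
    rw [← map_nsmul, ← he, smul_add, hVn v hv, zero_add]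
    exact (QuotientAddGroup.eq_zero_iff _).mpr (N.nsmul_mem hw n)
  refine (finite_range_of_ker_le hrank α β hαβ hn hβ).subset ?_
  rintro _ ⟨s, ⟨hs1, hs2⟩, rfl⟩
  obtain ⟨x, hx, y, hy, rfl⟩ := AddSubgroup.mem_sup.mp hs1
  exact ⟨⟨(⟨x, hx⟩, ⟨y, hy⟩), hs2⟩, rfl⟩

theorem TopologicallyModular.modularStructure [LocallyCompactSpace G] [T2Space G]
    [TotallyDisconnectedSpace G] (hdisc : ¬ DiscreteTopology G) (hper : ¬ IsPeriodicGroup G)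
    (h : TopologicallyModular G) : ModularStructure G (AddCommGroup.torsion G) := by
  obtain ⟨x, hx⟩ : ∃ x, x ∉ compSubgroup G := by
    by_contra! hcon
    exact hper ⟨inferInstance, hcon⟩
  have heq : AddCommGroup.torsion G = compSubgroup G :=
    le_antisymm torsion_le_compSubgroup (h.compSubgroup_le_torsion hx)
  have ho : IsOpen (AddCommGroup.torsion G : Set G) := heq ▸ isOpen_compSubgroup
  refine ⟨rfl, heq, ho, QuotientAddGroup.discreteTopology ho, inferInstance, ?_, ?_⟩
  · rw [zRank_eq_rank]; exact h.rank_lt_aleph0 hdisc ho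
  · rw [stronglyTopologicallyQuasihamiltonian_addSubgroup_iff (AddSubgroup.isClosed_of_isOpen _ ho)]
    intro X Y hX hY hXT hYT
    refine h.isClosed_sup ho (x := x) (fun m hm => ?_) hX hY hXT hYT
    rw [heq] at hm
    exact eq_zero_of_zsmul_mem_compSubgroup hx hm

omit [TopologicalSpace G] [IsTopologicalAddGroup G] in
theorem AddCommGroup.torsion_quotient_of_le_torsion {N : AddSubgroup G}
    (hN : N ≤ AddCommGroup.torsion G) : AddCommGroup.torsion (G ⧸ N) =
      (AddCommGroup.torsion G).map (QuotientAddGroup.mk' N) := by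
  ext y
  constructor
  · intro hy
    obtain ⟨x, rfl⟩ := QuotientAddGroup.mk'_surjective N y
    obtain ⟨n, hn, h⟩ := isOfFinAddOrder_iff_nsmul_eq_zero.mp (show IsOfFinAddOrder _ from hy)
    rw [← map_nsmul] at h
    have h1 : n • x ∈ N := (QuotientAddGroup.eq_zero_iff _).mp h
    obtain ⟨m, hm, h2⟩ := isOfFinAddOrder_iff_nsmul_eq_zero.mp (show IsOfFinAddOrder _ from hN h1)
    rw [smul_smul] at h2
    exact ⟨x, isOfFinAddOrder_iff_nsmul_eq_zero.mpr ⟨m * n, Nat.mul_pos hm hn, h2⟩, rfl⟩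
  · rintro ⟨x, hx, rfl⟩
    exact (QuotientAddGroup.mk' N).isOfFinAddOrder hx

/-- A compact subgroup has finite image modulo an open one, so a positive multiple of each of its
elements is torsion. -/
theorem compSubgroup_le_torsion_of_isOpen (ho : IsOpen (AddCommGroup.torsion G : Set G)) :
    compSubgroup G ≤ AddCommGroup.torsion G := by
  rintro c ⟨K, hK, hc⟩
  obtain ⟨m, hm, h⟩ := exists_nsmul_mem_of_isCompact hK ho hc
  obtain ⟨k, hk, h⟩ := isOfFinAddOrder_iff_nsmul_eq_zero.mp (show IsOfFinAddOrder _ from h)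
  rw [smul_smul] at h
  exact isOfFinAddOrder_iff_nsmul_eq_zero.mpr ⟨k * m, Nat.mul_pos hk hm, h⟩

omit [IsTopologicalAddGroup G] in
theorem AddSubgroup.isClosed_map_mk {N X : AddSubgroup G} (hNX : N ≤ X)
    (hX : IsClosed (X : Set G)) : IsClosed (X.map (QuotientAddGroup.mk' N) : Set (G ⧸ N)) := by
  rw [← (QuotientAddGroup.isQuotientMap_mk (N := N)).isClosed_preimage]
  have : ((X.map (QuotientAddGroup.mk' N)).comap (QuotientAddGroup.mk' N) : Set G) = X := by
    rw [AddSubgroup.comap_map_eq_self (by simpa using hNX)]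
  have hX' : IsClosed ((X.map (QuotientAddGroup.mk' N)).comap (QuotientAddGroup.mk' N) : Set G) := by
    rwa [this]
  exact hX'

/-- Closed subgroups of `T/N` pull back to closed subgroups of `T`; the sum of two pullbacks is
closed and contains `N`, so its image is closed. The rank is unchanged by the third isomorphism
theorem. -/
theorem ModularStructure.quotient {T N : AddSubgroup G} (h : ModularStructure G T) (hNT : N ≤ T) :
    ModularStructure (G ⧸ N) (T.map (QuotientAddGroup.mk' N)) := by
  have htor : T.map (QuotientAddGroup.mk' N) = AddCommGroup.torsion (G ⧸ N) := by
    rw [AddCommGroup.torsion_quotient_of_le_torsion (hNT.trans h.eq_torsion.le), ← h.eq_torsion]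
  have ho : IsOpen (T.map (QuotientAddGroup.mk' N) : Set (G ⧸ N)) :=
    QuotientAddGroup.isOpenMap_coe _ h.isOpen
  have hTc := T.isClosed_of_isOpen h.isOpen
  refine ⟨htor, ?_, ho, QuotientAddGroup.discreteTopology ho, ?_, ?_, ?_⟩
  · rw [htor] at ho ⊢
    exact le_antisymm torsion_le_compSubgroup (compSubgroup_le_torsion_of_isOpen ho)
  · rw [htor]; infer_instance
  · have hr := h.finite_rank_quotient
    rw [zRank_eq_rank] at hr ⊢
    rwa [(QuotientAddGroup.quotientQuotientEquivQuotient N T hNT).toIntLinearEquiv.rank_eq]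
  · have hq := (stronglyTopologicallyQuasihamiltonian_addSubgroup_iff hTc).mp
      h.strongly_quasihamiltonian
    rw [stronglyTopologicallyQuasihamiltonian_addSubgroup_iff (AddSubgroup.isClosed_of_isOpen _ ho)]
    intro X Y hX hY hXT hYT
    have hcomap : ∀ Z ≤ T.map (QuotientAddGroup.mk' N), Z.comap (QuotientAddGroup.mk' N) ≤ T := by
      intro Z hZ
      refine (AddSubgroup.comap_mono hZ).trans ?_
      rw [AddSubgroup.comap_map_eq_self (by simpa using hNT)]
    have hsurj := QuotientAddGroup.mk'_surjective N
    have h1 := hq (X.comap (QuotientAddGroup.mk' N)) (Y.comap (QuotientAddGroup.mk' N))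
      (hX.preimage QuotientAddGroup.continuous_mk) (hY.preimage QuotientAddGroup.continuous_mk)
      (hcomap X hXT) (hcomap Y hYT)
    have hNle : N ≤ X.comap (QuotientAddGroup.mk' N) := by
      intro y hy
      change QuotientAddGroup.mk' N y ∈ X
      rw [show QuotientAddGroup.mk' N y = 0 from (QuotientAddGroup.eq_zero_iff y).mpr hy]
      exact X.zero_mem
    have h2 := AddSubgroup.isClosed_map_mk (hNle.trans le_sup_left) h1
    rwa [AddSubgroup.map_sup, AddSubgroup.map_comap_eq_self_of_surjective hsurj,
      AddSubgroup.map_comap_eq_self_of_surjective hsurj] at h2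

end StructureTheorem

theorem theorem4 (G : Type*) [AddCommGroup G] [TopologicalSpace G] [IsTopologicalAddGroup G]
    [LocallyCompactSpace G] [T2Space G] [TotallyDisconnectedSpace G]
    (hdisc : ¬ DiscreteTopology G) (hper : ¬ IsPeriodicGroup G) :
    List.TFAE [TopologicallyModular G,
      ModularStructure G (AddCommGroup.torsion G),
      StronglyTopologicallyQuasihamiltonian G] ∧
    ∀ N : AddSubgroup G, IsClosed (N : Set G) → N ≤ AddCommGroup.torsion G →
      AddCommGroup.torsion (G ⧸ N) = (AddCommGroup.torsion G).map (QuotientAddGroup.mk' N) ∧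
      (ModularStructure G (AddCommGroup.torsion G) →
        ModularStructure (G ⧸ N) ((AddCommGroup.torsion G).map (QuotientAddGroup.mk' N))) := by
  refine ⟨?_, fun N _ hN =>
    ⟨AddCommGroup.torsion_quotient_of_le_torsion hN, fun h => h.quotient hN⟩⟩
  tfae_have 1 → 2 := fun h => h.modularStructure hdisc hper
  tfae_have 2 → 3 := fun h => h.stronglyTopologicallyQuasihamiltonian
  tfae_have 3 → 1 := fun h => h.topologicallyModular
  tfae_finish
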